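/- All polynomials are over $\mathrm{GF}(2)$. A trinomial is a polynomial $x^n+x^s+1$ with integers $n>s>0$. A polynomial $P$ of degree $n$ is called almost irreducible if $P(0)\neq 0$ and $P$ has an irreducible factor of degree $r$ for some $r>n/2$; this $r$ is unique, it is called the exponent of $P$, and $n-r$ is called the increment of $P$. Theorem. If $T$ is an almost irreducible trinomial over $\mathrm{GF}(2)$ with exponent $13466917$ and increment $\delta$, then $\delta\notin\{0,1,2,4\}$. -/

import Mathlib

open Polynomial

/-- A trinomial over `GF(2)`: a polynomial `x^n + x^s + 1` with `n > s > 0`. -/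
def IsTrinomial (T : (ZMod 2)[X]) : Prop :=
  ∃ n s : ℕ, 0 < s ∧ s < n ∧ T = X ^ n + X ^ s + 1

/-- `P` is almost irreducible with exponent `r`: `P(0) ≠ 0` and `P` has an irreducible factor of
degree `r`, where `r > deg P / 2`. -/
def HasExponent (P : (ZMod 2)[X]) (r : ℕ) : Prop :=
  P.eval 0 ≠ 0 ∧ P.natDegree < 2 * r ∧ ∃ D : (ZMod 2)[X], Irreducible D ∧ D ∣ P ∧ D.natDegree = r

/-- `P` is almost irreducible if it has some exponent (which is then unique). -/
def IsAlmostIrreducible (P : (ZMod 2)[X]) : Prop :=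
  ∃ r : ℕ, HasExponent P r

/-- The increment of an almost irreducible polynomial of degree `n` and exponent `r` is
`δ = n - r`; it is written here as `n = r + δ`, so that no truncated subtraction occurs. -/
def HasIncrement (P : (ZMod 2)[X]) (δ : ℕ) : Prop :=
  ∃ r : ℕ, HasExponent P r ∧ P.natDegree = r + δ

/-! The argument is Swan's parity theorem applied to `T = D * h` with `h` of degree δ. Passing to
the reciprocal trinomial makes the middle exponent `k` even when `n` is odd. If `k ∤ 2n` and `n ≡ 1`
mod 4, the discriminant of the integral lift is `n` mod 8, so by Stickelberger the Frobenius
permutation of the roots is even exactly when `n ≡ 1` mod 8 (`exists_frobenius_perm_roots`).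

For δ = 0, `n ≡ 5` mod 8 makes Frobenius odd, while irreducibility gives it odd order; hence `k ∣
2n`, and since `n` is prime `k = 2`, where `X ^ 2 + X + 1` is a factor. For δ = 4, `n ≡ 1` mod 8
makes Frobenius even, while an irreducible quartic factor turns its power with exponent `deg D` into
a 4-cycle; hence again `k ∣ 2n`, and the few such `k` are excluded modulo 15. For δ = 1 there is no
root in GF(2); for δ = 2 the cofactor would be `X ^ 2 + X + 1`, impossible as `3 ∣ n`. -/

/-! ### The discriminant of the trinomial modulo 8. -/

/-- Truncated expansion of `∏ (a + b uᵢ)` up to terms divisible by `b ^ 3`. -/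
theorem exists_sq_mul_prod_add_mul {R ι : Type*} [CommRing R] (a b : R) (u : ι → R)
    (s : Finset ι) :
    ∃ e r : R, 2 * e = (∑ i ∈ s, u i) ^ 2 - ∑ i ∈ s, u i ^ 2 ∧
      a ^ 2 * ∏ i ∈ s, (a + b * u i) =
        a ^ s.card * (a ^ 2 + a * b * ∑ i ∈ s, u i + b ^ 2 * e) + b ^ 3 * r := by
  classical
  induction s using Finset.induction_on with
  | empty => exact ⟨0, 0, by simp, by simp⟩
  | insert x s hx ih =>
    obtain ⟨e, r, he, h⟩ := ih
    refine ⟨e + u x * ∑ i ∈ s, u i, r * (a + b * u x) + a ^ s.card * u x * e, ?_, ?_⟩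
    · rw [Finset.sum_insert hx, Finset.sum_insert hx]
      linear_combination he
    · rw [Finset.prod_insert hx, Finset.sum_insert hx, Finset.card_insert_of_notMem hx, pow_succ]
      linear_combination (a + b * u x) * h

/-- Below `n`, Newton's identities involve only the elementary symmetric function of index `n - m`;
from `n` on, the trinomial gives a recurrence. Either way a nonzero power sum comes from one whose
index is smaller by `n - m` or `n`. -/
theorem psum_ne_zero_imp {R : Type*} [CommRing R] [IsDomain R] {n m : ℕ} (hm : 0 < m)
    (hmn : m < n) (w : Fin n → R) (hw : ∏ i, (X - C (w i)) = (X ^ n + X ^ m + 1 : R[X])) (j : ℕ)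
    (hj : 0 < j) (h : ∑ i, w i ^ j ≠ 0) : ∃ a b : ℕ, j = a * (n - m) + b * n := by
  induction j using Nat.strong_induction_on with
  | _ j ih =>
  by_cases hjn : n ≤ j
  · obtain ⟨t, rfl⟩ := Nat.exists_eq_add_of_le hjn
    have hroot (i : Fin n) : w i ^ n + w i ^ m + 1 = 0 := by
      have := congrArg (eval (w i)) hw
      rw [eval_prod, Finset.prod_eq_zero (Finset.mem_univ i) (by simp)] at this
      simpa using this.symm
    have hrec : ∑ i, w i ^ (n + t) + ∑ i, w i ^ (m + t) + ∑ i, w i ^ t = 0 := by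
      rw [← Finset.sum_add_distrib, ← Finset.sum_add_distrib]
      refine Finset.sum_eq_zero fun i _ => ?_
      rw [pow_add, pow_add]
      linear_combination w i ^ t * hroot i
    rcases Nat.eq_zero_or_pos t with rfl | ht
    · exact ⟨0, 1, by simp⟩
    by_cases h0 : ∑ i, w i ^ t = 0
    · have h1 : ∑ i, w i ^ (m + t) ≠ 0 := fun h1 => h (by simpa [h0, h1] using hrec)
      obtain ⟨a, b, hab⟩ := ih (m + t) (by omega) (by omega) h1
      exact ⟨a + 1, b, by rw [add_mul]; omega⟩
    · obtain ⟨a, b, hab⟩ := ih t (by omega) ht h0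
      exact ⟨a, b + 1, by rw [add_mul b]; omega⟩
  · have hes (i : ℕ) (hi : 0 < i) (hin : i < n) (hne : i ≠ n - m) :
        MvPolynomial.aeval w (MvPolynomial.esymm (Fin n) R i) = 0 := by
      rw [MvPolynomial.aeval_esymm_eq_multiset_esymm]
      have hc := Multiset.prod_X_sub_C_coeff (Finset.univ.val.map w) (k := n - i) (by simp)
      rw [Multiset.map_map] at hc
      have h2 : (Multiset.map ((fun t => X - C t) ∘ w) Finset.univ.val).prod
          = ∏ i, (X - C (w i)) := rfl
      rw [h2, hw] at hc
      have hcoef : (X ^ n + X ^ m + 1 : R[X]).coeff (n - i) = 0 := by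
        rw [coeff_add, coeff_add, coeff_X_pow, coeff_X_pow, coeff_one, if_neg (by omega),
          if_neg (by omega), if_neg (by omega)]
        simp
      rw [hcoef] at hc
      simp only [Multiset.card_map, Finset.card_val, Finset.card_univ, Fintype.card_fin] at hc
      rw [show n - (n - i) = i by omega] at hc
      simpa using hc.symm
    by_cases hjk : j = n - m
    · exact ⟨1, 0, by simpa using hjk⟩
    have hN := congrArg (MvPolynomial.aeval w) (MvPolynomial.psum_eq_mul_esymm_sub_sum (Fin n) R j hj)
    simp only [map_sub, map_mul, map_sum, hes j hj (by omega) hjk, mul_zero, zero_sub,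
      MvPolynomial.psum, map_pow, MvPolynomial.aeval_X] at hN
    obtain ⟨x, hx, hx0⟩ := Finset.exists_ne_zero_of_sum_ne_zero
      (fun h0 => h (by rw [hN, h0, neg_zero]))
    obtain ⟨hx1, hx2⟩ := Finset.mem_filter.mp hx
    rw [Finset.HasAntidiagonal.mem_antidiagonal] at hx1
    rw [Set.mem_Ioo] at hx2
    have hxk : x.1 = n - m := by
      by_contra hne
      exact hx0 (by rw [hes x.1 (by omega) (by omega) hne]; ring)
    obtain ⟨a, b, hab⟩ := ih x.2 (by omega) (by omega) (right_ne_zero_of_mul hx0)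
    exact ⟨a + 1, b, by rw [add_mul]; omega⟩

/-- The derivative of `∏ (X - vᵢ)` at a root. -/
theorem eval_derivative_prod_X_sub_C {R : Type*} [CommRing R] {n : ℕ} (v : Fin n → R) (i : Fin n) :
    (derivative (∏ i, (X - C (v i)))).eval (v i) = ∏ j ∈ {i}ᶜ, (v i - v j) := by
  rw [← Finset.prod_mul_prod_compl {i}]
  simp [derivative_mul, eval_prod]

/-- The usual sign is trivial, as `n (n - 1) / 2` is even. -/
theorem prod_prod_compl_eq_sq {R : Type*} [CommRing R] {n : ℕ} (hn : n % 4 = 1) (v : Fin n → R) :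
    ∏ i, ∏ j ∈ {i}ᶜ, (v i - v j) = (Matrix.vandermonde v).det ^ 2 := by
  rw [← Finset.prod_prod_Ioi_mul_eq_prod_prod_off_diag (fun j i => v i - v j),
    Matrix.det_vandermonde, ← Finset.prod_pow]
  have h1 (i : Fin n) : ∏ j ∈ Finset.Ioi i, ((v i - v j) * (v j - v i)) =
      (-1) ^ (n - 1 - (i : ℕ)) * (∏ j ∈ Finset.Ioi i, (v j - v i)) ^ 2 := by
    rw [← Fin.card_Ioi, ← Finset.prod_const, ← Finset.prod_pow, ← Finset.prod_mul_distrib]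
    exact Finset.prod_congr rfl fun j _ => by ring
  simp_rw [h1]
  rw [Finset.prod_mul_distrib, Finset.prod_pow_eq_pow_sum,
    Fin.sum_univ_eq_sum_range (fun i => n - 1 - i), Finset.sum_range_reflect (fun i => i),
    Finset.sum_range_id, Even.neg_one_pow, one_mul]
  obtain ⟨t, rfl⟩ : ∃ t, n = 4 * t + 1 := ⟨n / 4, by omega⟩
  rw [show (4 * t + 1) * (4 * t + 1 - 1) = ((4 * t + 1) * t * 2) * 2 by
    rw [Nat.add_sub_cancel]; ring, Nat.mul_div_cancel _ two_pos]
  exact even_two.mul_left _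

theorem mul_eval_derivative_trinomial {R : Type*} [CommRing R] {n k : ℕ} (hn : 0 < n) (hk : 0 < k)
    (x : R) : x * (derivative (X ^ n + X ^ k + 1 : R[X])).eval x = n * x ^ n + k * x ^ k := by
  obtain ⟨n, rfl⟩ := Nat.exists_eq_succ_of_ne_zero hn.ne'
  obtain ⟨k, rfl⟩ := Nat.exists_eq_succ_of_ne_zero hk.ne'
  simp
  ring

theorem prod_roots_of_odd {R : Type*} [CommRing R] {n k : ℕ} (hn : Odd n) (hk : 0 < k)
    (v : Fin n → R) (hv : ∏ i, (X - C (v i)) = (X ^ n + X ^ k + 1 : R[X])) : ∏ i, v i = -1 := by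
  have := congrArg (eval 0) hv
  simp [eval_prod, Finset.prod_neg, hn.neg_one_pow, hn.pos.ne', hk.ne'] at this
  linear_combination -this

theorem natDegree_trinomial {R : Type*} [CommRing R] [Nontrivial R] {n k : ℕ} (hkn : k < n) :
    (X ^ n + X ^ k + 1 : R[X]).natDegree = n := by
  have h1 : (X ^ n + X ^ k : R[X]).natDegree = n := by
    rw [natDegree_add_eq_left_of_natDegree_lt] <;> simp [hkn]
  rw [natDegree_add_eq_left_of_natDegree_lt, h1]
  rw [h1, natDegree_one]
  omega

theorem reverse_trinomial {R : Type*} [CommRing R] [IsDomain R] {n k : ℕ} (hkn : k < n) :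
    (X ^ n + X ^ k + 1 : R[X]).reverse = X ^ n + X ^ (n - k) + 1 := by
  rw [reverse, natDegree_trinomial hkn, reflect_add, reflect_add, reflect_one, reflect_monomial,
    reflect_monomial, revAt_le le_rfl, revAt_le hkn.le, Nat.sub_self, pow_zero]
  ring

theorem reverse_prod {R ι : Type*} [CommRing R] [IsDomain R] (s : Finset ι) (f : ι → R[X]) :
    (∏ i ∈ s, f i).reverse = ∏ i ∈ s, (f i).reverse := by
  classical
  induction s using Finset.induction_on with
  | empty => simpa using reverse_C (1 : R)
  | insert x s hx ih => rw [Finset.prod_insert hx, Finset.prod_insert hx, reverse_mul_of_domain, ih]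

theorem reverse_X_sub_C {R : Type*} [CommRing R] [IsDomain R] (v : R) :
    (X - C v).reverse = 1 - C v * X := by
  rw [reverse, natDegree_X_sub_C, sub_eq_add_neg, ← C_neg, reflect_add, reflect_C]
  nth_rw 1 [← pow_one (X : R[X])]
  rw [reflect_monomial, revAt_le le_rfl]
  simp [sub_eq_add_neg]

/-- The reciprocals of the roots of `X ^ n + X ^ k + 1`. -/
theorem exists_inv_roots {R : Type*} [CommRing R] [IsDomain R] {n k : ℕ} (hn : Odd n) (hk : 0 < k)
    (hkn : k < n) (v : Fin n → R)
    (hv : ∏ i, (X - C (v i)) = (X ^ n + X ^ k + 1 : R[X])) :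
    ∃ w : Fin n → R, (∀ i, v i * w i = 1) ∧
      ∏ i, (X - C (w i)) = (X ^ n + X ^ (n - k) + 1 : R[X]) := by
  have hroot (i : Fin n) : v i ^ n + v i ^ k + 1 = 0 := by
    have := congrArg (eval (v i)) hv
    rw [eval_prod, Finset.prod_eq_zero (Finset.mem_univ i) (by simp)] at this
    simpa using this.symm
  -- The root equation reads `v * (v ^ (n - 1) + v ^ (k - 1)) = -1`, so inverses exist already in
  -- the ring.
  refine ⟨fun i => -(v i ^ (n - 1) + v i ^ (k - 1)), fun i => ?_, ?_⟩
  · have h1 : v i ^ n = v i * v i ^ (n - 1) := by rw [← pow_succ']; congr 1; omega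
    have h2 : v i ^ k = v i * v i ^ (k - 1) := by rw [← pow_succ']; congr 1; omega
    linear_combination -hroot i + h1 + h2
  · have hvw (i : Fin n) : (X - C (v i)).reverse =
        -C (v i) * (X - C (-(v i ^ (n - 1) + v i ^ (k - 1)))) := by
      rw [reverse_X_sub_C]
      have h1 : v i * -(v i ^ (n - 1) + v i ^ (k - 1)) = 1 := by
        have h1 : v i ^ n = v i * v i ^ (n - 1) := by rw [← pow_succ']; congr 1; omega
        have h2 : v i ^ k = v i * v i ^ (k - 1) := by rw [← pow_succ']; congr 1; omega
        linear_combination -hroot i + h1 + h2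
      have h2 := congrArg C h1
      rw [C_mul, C_1] at h2
      linear_combination -h2
    rw [← reverse_trinomial hkn, ← hv, reverse_prod]
    simp_rw [hvw]
    rw [Finset.prod_mul_distrib, Finset.prod_neg, ← map_prod, prod_roots_of_odd hn hk v hv,
      Finset.card_univ, Fintype.card_fin, hn.neg_one_pow]
    simp

theorem exists_disc_eq_add_eight_mul {R : Type*} [CommRing R] [IsDomain R] [CharZero R] {n k : ℕ}
    (hn : n % 4 = 1) (hk : 0 < k) (hke : Even k) (hkn : k < n) (hdvd : ¬ k ∣ 2 * n)
    (v : Fin n → R) (hv : ∏ i, (X - C (v i)) = (X ^ n + X ^ k + 1 : R[X])) :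
    ∃ y : R, (Matrix.vandermonde v).det ^ 2 = n + 8 * y := by
  have hodd : Odd n := by rw [Nat.odd_iff]; omega
  obtain ⟨w, hw, hwp⟩ := exists_inv_roots hodd hk hkn v hv
  have hke' := hke
  obtain ⟨k', rfl⟩ := hke'
  -- The exponent `n - k` is odd and below `n`, so it is not `a * k + b * n`.
  have hp1 : ∑ i, w i ^ (n - (k' + k')) = 0 := by
    by_contra h
    obtain ⟨a, b, hab⟩ := psum_ne_zero_imp (by omega) (by omega) w hwp _ (by omega) h
    rw [Nat.sub_sub_self hkn.le] at hab
    rcases Nat.eq_zero_or_pos b with rfl | hb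
    · have : a * (k' + k') = 2 * (a * k') := by ring
      omega
    · have : n ≤ b * n := Nat.le_mul_of_pos_left n hb
      omega
  -- Here `b = 0` would give `k ∣ 2n`, and `b = 1` fails by parity.
  have hp2 : ∑ i, (w i ^ (n - (k' + k'))) ^ 2 = 0 := by
    by_contra h
    simp_rw [← pow_mul] at h
    obtain ⟨a, b, hab⟩ := psum_ne_zero_imp (by omega) (by omega) w hwp _ (by omega) h
    rw [Nat.sub_sub_self hkn.le] at hab
    have h1 : a * (k' + k') = 2 * (a * k') := by ring
    rcases (by omega : b = 0 ∨ b = 1 ∨ 2 ≤ b) with rfl | rfl | hb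
    · exact hdvd ⟨a + 2, by rw [mul_add, mul_comm _ a]; omega⟩
    · omega
    · have : 2 * n ≤ b * n := Nat.mul_le_mul_right n hb
      omega
  -- From `x f'(x) = n x ^ n + k x ^ k`, factor out `x ^ n`. Expanding in `k`, the terms of order
  -- one and two vanish, and `8 ∣ k ^ 3`.
  have hD : (Matrix.vandermonde v).det ^ 2 =
      ∏ i, ((n : R) + (k' + k' : ℕ) * w i ^ (n - (k' + k'))) := by
    have h1 := prod_roots_of_odd hodd hk v hv
    have h2 : (∏ i, v i) * ∏ i, ∏ j ∈ {i}ᶜ, (v i - v j) =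
        (∏ i, v i) ^ n * ∏ i, ((n : R) + (k' + k' : ℕ) * w i ^ (n - (k' + k'))) := by
      rw [← Finset.prod_mul_distrib, ← Finset.prod_pow, ← Finset.prod_mul_distrib]
      refine Finset.prod_congr rfl fun i _ => ?_
      rw [← eval_derivative_prod_X_sub_C, hv, mul_eval_derivative_trinomial hodd.pos hk]
      have h3 : v i ^ n = v i ^ (k' + k') * v i ^ (n - (k' + k')) := by
        rw [← pow_add]; congr 1; omega
      have h4 : v i ^ (n - (k' + k')) * w i ^ (n - (k' + k')) = 1 := by
        rw [← mul_pow, hw, one_pow]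
      linear_combination (-((k' + k' : ℕ) : R) * w i ^ (n - (k' + k'))) * h3
        - ((k' + k' : ℕ) : R) * v i ^ (k' + k') * h4
    rw [h1, hodd.neg_one_pow, prod_prod_compl_eq_sq hn] at h2
    linear_combination -h2
  obtain ⟨e, r, he, h⟩ := exists_sq_mul_prod_add_mul (n : R) (k' + k' : ℕ)
    (fun i => w i ^ (n - (k' + k'))) Finset.univ
  rw [hp1, hp2] at he
  have he0 : e = 0 := by simpa using he
  rw [← hD, hp1, he0, Finset.card_univ, Fintype.card_fin] at h
  obtain ⟨t, ht⟩ : ∃ t, n ^ 2 = 8 * t + 1 := by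
    have : n ^ 2 % 8 = 1 := by
      have h8 : n % 8 = 1 ∨ n % 8 = 5 := by omega
      rcases h8 with h8 | h8 <;> simp [Nat.pow_mod, h8]
    exact ⟨n ^ 2 / 8, by omega⟩
  obtain ⟨s, hs⟩ : ∃ s, n ^ n = n + 8 * s := by
    obtain ⟨q, hq⟩ := hodd
    have h1 : n ^ n = n * (n ^ 2) ^ q := by
      rw [← pow_mul, ← pow_succ']; congr 1
    have h2 : (n ^ 2) ^ q % 8 = 1 := by
      rw [ht, Nat.pow_mod]; simp [Nat.add_mod]
    exact ⟨n * ((n ^ 2) ^ q / 8), by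
      rw [h1]; nth_rw 1 [← Nat.div_add_mod ((n ^ 2) ^ q) 8]; rw [h2]; ring⟩
  have ht' : (n : R) ^ 2 = 8 * t + 1 := by exact_mod_cast congrArg (Nat.cast (R := R)) ht
  have hs' : (n : R) ^ n = n + 8 * s := by exact_mod_cast congrArg (Nat.cast (R := R)) hs
  push_cast at h
  refine ⟨s * n ^ 2 + n * t + k' ^ 3 * r - t * (Matrix.vandermonde v).det ^ 2, ?_⟩
  linear_combination h + (n : R) ^ 2 * hs' + (n - (Matrix.vandermonde v).det ^ 2) * ht'

/-! ### Stickelberger's parity argument. -/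

theorem map_det_vandermonde {R S : Type*} [CommRing R] [CommRing S] {n : ℕ} (v : Fin n → R)
    (w : Fin n → S) (f : R →+* S) (π : Equiv.Perm (Fin n)) (h : ∀ i, f (v i) = w (π i)) :
    f (Matrix.vandermonde v).det = Equiv.Perm.sign π * (Matrix.vandermonde w).det := by
  rw [← Matrix.det_permute, RingHom.map_det]
  congr 1
  ext i j
  simp [Matrix.vandermonde_apply, h]

/-- `S = ∏_{i<j} (vᵢ + vⱼ)` is fixed by every ring map permuting the `vᵢ`. -/
theorem map_prod_add_eq {R : Type*} [CommRing R] [IsDomain R] {n : ℕ} (v : Fin n → R)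
    (hd : (Matrix.vandermonde v).det ≠ 0) (f : R →+* R) (π : Equiv.Perm (Fin n))
    (h : ∀ i, f (v i) = v (π i)) :
    f (∏ i, ∏ j ∈ Finset.Ioi i, (v j + v i)) = ∏ i, ∏ j ∈ Finset.Ioi i, (v j + v i) := by
  -- Both Vandermonde determinants in this identity pick up the same sign under the permutation, so
  -- their quotient is fixed.
  have hS : (∏ i, ∏ j ∈ Finset.Ioi i, (v j + v i)) * (Matrix.vandermonde v).det =
      (Matrix.vandermonde fun i => v i ^ 2).det := by
    rw [Matrix.det_vandermonde, Matrix.det_vandermonde, ← Finset.prod_mul_distrib]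
    refine Finset.prod_congr rfl fun i _ => ?_
    rw [← Finset.prod_mul_distrib]
    exact Finset.prod_congr rfl fun j _ => by ring
  have h1 := congrArg f hS
  rw [map_mul, map_det_vandermonde v v f π h,
    map_det_vandermonde (fun i => v i ^ 2) (fun i => v i ^ 2) f π (by simp [h]), ← hS] at h1
  have hs : ((Equiv.Perm.sign π : ℤ) : R) ≠ 0 := by
    rcases Int.units_eq_one_or (Equiv.Perm.sign π) with h | h <;> simp [h]
  refine mul_right_cancel₀ (mul_ne_zero hs hd) ?_
  linear_combination h1

theorem exists_det_vandermonde_eq_prod_add {R : Type*} [CommRing R] {n : ℕ} (v : Fin n → R) :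
    ∃ b : R, (Matrix.vandermonde v).det = (∏ i, ∏ j ∈ Finset.Ioi i, (v j + v i)) + 2 * b := by
  have h : (2 : R) ∣ (Matrix.vandermonde v).det - ∏ i, ∏ j ∈ Finset.Ioi i, (v j + v i) := by
    rw [← Ideal.mem_span_singleton, ← Ideal.Quotient.eq, Matrix.det_vandermonde]
    have h2 : (Ideal.Quotient.mk (Ideal.span {(2 : R)})) 2 = 0 :=
      Ideal.Quotient.eq_zero_iff_mem.mpr (Ideal.mem_span_singleton_self 2)
    simp only [map_prod, map_sub, map_add]
    refine Finset.prod_congr rfl fun i _ => Finset.prod_congr rfl fun j _ => ?_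
    rw [map_ofNat] at h2
    linear_combination (-(Ideal.Quotient.mk (Ideal.span {(2 : R)})) (v i)) * h2
  obtain ⟨b, hb⟩ := h
  exact ⟨b, by linear_combination hb⟩

/-- Stickelberger's parity argument: the sign of a Frobenius at a prime above `2`, acting on the
roots of a polynomial with odd discriminant `D`, is read off from `D` modulo `8`. -/
theorem sign_frobenius {R : Type*} [CommRing R] [IsDomain R] [CharZero R] {n d : ℕ}
    (v : Fin n → R) (P : Ideal R) [P.IsPrime] (h2 : (2 : R) ∈ P) (f : R →+* R)
    (hf : ∀ x, f x - x ^ 2 ∈ P) (π : Equiv.Perm (Fin n)) (h : ∀ i, f (v i) = v (π i)) (m : ℤ)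
    (hm : ∏ i, ∏ j ∈ Finset.Ioi i, (v j + v i) = m) (y : R) (hd : d % 4 = 1)
    (hD : (Matrix.vandermonde v).det ^ 2 = d + 8 * y) :
    Equiv.Perm.sign π = if d % 8 = 1 then 1 else -1 := by
  obtain ⟨b, hb⟩ := exists_det_vandermonde_eq_prod_add v
  rw [hm] at hb
  obtain ⟨q, rfl⟩ : ∃ q, d = 4 * q + 1 := ⟨d / 4, by omega⟩
  have hone : (1 : R) ∉ P := fun h1 => Ideal.IsPrime.ne_top' ((Ideal.eq_top_iff_one P).mpr h1)
  have hm2 : m % 2 = 1 := by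
    by_contra hm2
    obtain ⟨t, rfl⟩ : ∃ t, m = 2 * t := ⟨m / 2, by omega⟩
    apply hone
    have : (1 : R) = 2 * (2 * (t + b) ^ 2 - 2 * q - 4 * y) := by
      push_cast at hb hD
      rw [hb] at hD
      linear_combination -hD
    rw [this]
    exact P.mul_mem_right _ h2
  obtain ⟨t, ht⟩ : ∃ t, m ^ 2 = 8 * t + 1 := by
    obtain ⟨s, rfl⟩ : ∃ s, m = 2 * s + 1 := ⟨m / 2, by omega⟩
    obtain ⟨t, ht⟩ := Int.even_mul_succ_self s
    exact ⟨t, by linear_combination 4 * ht⟩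
  have htR : (m : R) ^ 2 = 8 * t + 1 := by exact_mod_cast congrArg (Int.cast (R := R)) ht
  -- Modulo 2, `b` is a root of `z ^ 2 + z = q`. It is rational over the prime field exactly when
  -- `q` is even, that is, when `d ≡ 1` mod 8.
  have hc : b ^ 2 + m * b = q + 2 * (y - t) := by
    have : (4 : R) * (b ^ 2 + m * b) = 4 * (q + 2 * (y - t)) := by
      rw [hb] at hD
      push_cast at hD
      linear_combination hD - htR
    exact mul_left_cancel₀ (by norm_num) this
  obtain ⟨s, rfl⟩ : ∃ s, m = 2 * s + 1 := ⟨m / 2, by omega⟩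
  push_cast at hb hc
  have hfb := map_det_vandermonde v v f π h
  rw [hb] at hfb
  simp only [map_add, map_mul, map_one, map_ofNat, map_intCast] at hfb
  have hmem := hf b
  have hq2 (q' : ℕ) (z : R) (hz : (q' : R) + 2 * z ∈ P) : q' % 2 = 0 := by
    by_contra hne
    obtain ⟨q'', rfl⟩ : ∃ q'', q' = 2 * q'' + 1 := ⟨q' / 2, by omega⟩
    apply hone
    have := P.sub_mem hz (P.mul_mem_right (q'' + z) h2)
    push_cast at this
    ring_nf at this
    exact this
  -- An even `π` fixes `b`; an odd one exchanges the two roots `b` and `-b - m`. Compare with `f b ≡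
  -- b ^ 2` mod `P`.
  rcases Int.units_eq_one_or (Equiv.Perm.sign π) with hs | hs
  · rw [hs] at hfb ⊢
    have hfb' : f b = b := mul_left_cancel₀ (two_ne_zero (α := R)) (by
      push_cast at hfb
      linear_combination hfb)
    rw [hfb'] at hmem
    have := hq2 q (y - t - s * b - b) (by
      convert P.neg_mem hmem using 1
      linear_combination -hc)
    rw [if_pos (by omega)]
  · rw [hs] at hfb ⊢
    have hfb' : f b = -b - (2 * s + 1) := mul_left_cancel₀ (two_ne_zero (α := R)) (by
      push_cast at hfb
      linear_combination hfb)
    rw [hfb'] at hmem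
    have := hq2 (q + 1) (y - t - s * b + s) (by
      convert P.neg_mem hmem using 1
      push_cast
      linear_combination -hc)
    rw [if_neg (by omega)]

/-! ### Reduction from a number field: Swan's theorem. -/

theorem monic_trinomial {R : Type*} [CommRing R] [Nontrivial R] {n k : ℕ} (hkn : k < n) :
    (X ^ n + X ^ k + 1 : R[X]).Monic := by
  rw [Monic, leadingCoeff, natDegree_trinomial hkn]
  simp [coeff_one, hkn.ne', (Nat.zero_le k).trans_lt hkn |>.ne']

theorem exists_fin_prod_X_sub_C {K : Type*} [Field K] {n : ℕ} (p : K[X]) (hp : p.Monic)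
    (hs : p.Splits) (hn : p.natDegree = n) : ∃ v : Fin n → K, ∏ i, (X - C (v i)) = p := by
  obtain ⟨l, hl⟩ := Quot.exists_rep p.roots
  have hl' : (l : Multiset K) = p.roots := hl
  obtain rfl : l.length = n := by
    rw [← hn, hs.natDegree_eq_card_roots, ← hl', Multiset.coe_card]
  refine ⟨fun i => l[i], ?_⟩
  refine (Fin.prod_univ_fun_getElem l (fun x => X - C x)).trans ?_
  conv_rhs => rw [hs.eq_prod_roots_of_monic hp, ← hl']
  simp

theorem exists_perm_of_map_root {R : Type*} [CommRing R] [IsDomain R] {n k : ℕ} (v : Fin n → R)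
    (hv : ∏ i, (X - C (v i)) = (X ^ n + X ^ k + 1 : R[X])) (hinj : Function.Injective v)
    (f : R →+* R) (hf : Function.Injective f) :
    ∃ π : Equiv.Perm (Fin n), ∀ i, f (v i) = v (π i) := by
  have hex (i : Fin n) : ∃ j, f (v i) = v j := by
    have h1 := congrArg (eval (v i)) hv
    rw [eval_prod, Finset.prod_eq_zero (Finset.mem_univ i) (by simp)] at h1
    have h2 := congrArg f h1
    have h3 := congrArg (eval (f (v i))) hv
    simp only [eval_prod, eval_add, eval_pow, eval_X, eval_one, eval_sub, eval_C] at h2 h3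
    simp only [map_add, map_pow, map_one, map_zero] at h2
    rw [← h2] at h3
    obtain ⟨j, -, hj⟩ := Finset.prod_eq_zero_iff.mp h3
    exact ⟨j, sub_eq_zero.mp hj⟩
  choose g hg using hex
  have hgi : Function.Injective g := fun i j hij =>
    hinj (hf (by rw [hg, hg, hij]))
  exact ⟨Equiv.ofBijective g (Finite.injective_iff_bijective.mp hgi), hg⟩

/-- Frobenius elements above `2` in the ring of integers of a Galois number field. -/
theorem exists_frobenius_two (L : Type) [Field L] [NumberField L] [IsGalois ℚ L] :
    ∃ (P : Ideal (NumberField.RingOfIntegers L)) (_ : P.IsMaximal)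
      (f : NumberField.RingOfIntegers L ≃ₐ[ℤ] NumberField.RingOfIntegers L),
      (2 : NumberField.RingOfIntegers L) ∈ P ∧ ∀ x, f x - x ^ 2 ∈ P := by
  have h2 : Prime (2 : ℤ) := Int.prime_two
  let p : Ideal ℤ := Ideal.span {2}
  have : p.IsPrime := (Ideal.span_singleton_prime two_ne_zero).mpr h2
  have hp0 : p ≠ ⊥ := by simp [p]
  have : p.IsMaximal := Ideal.IsPrime.isMaximal inferInstance hp0
  obtain ⟨P, hPm, hP⟩ := Ideal.exists_maximal_ideal_liesOver_of_isIntegral p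
    (S := NumberField.RingOfIntegers L)
  have := Algebra.isInvariant_of_isGalois' ℤ ℚ L (NumberField.RingOfIntegers L)
  have : Finite (NumberField.RingOfIntegers L ≃ₐ[ℤ] NumberField.RingOfIntegers L) :=
    Finite.of_equiv _ (galRestrict ℤ ℚ L (NumberField.RingOfIntegers L)).toEquiv
  have hP0 : P ≠ ⊥ := Ideal.ne_bot_of_liesOver_of_ne_bot hp0 P
  have : Finite (NumberField.RingOfIntegers L ⧸ P) := Ideal.finiteQuotientOfFreeOfNeBot P hP0
  obtain ⟨f, hf⟩ := IsArithFrobAt.exists_of_isInvariant ℤ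
    (NumberField.RingOfIntegers L ≃ₐ[ℤ] NumberField.RingOfIntegers L) P
  refine ⟨P, hPm, f, ?_, ?_⟩
  · have : (2 : ℤ) ∈ P.under ℤ := by
      rw [← hP.over]; exact Ideal.mem_span_singleton_self 2
    simpa [Ideal.under] using this
  · have hc : Nat.card (ℤ ⧸ P.under ℤ) = 2 := by
      rw [← hP.over]
      simpa [p] using Int.card_ideal_quot 2
    intro x
    have := hf x
    rw [MulSemiringAction.toAlgHom_apply, hc] at this
    exact this

open NumberField in
theorem exists_frobenius_perm_roots_of_prod {n k : ℕ} (hn : n % 4 = 1) (hk : 0 < k) (hke : Even k)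
    (hkn : k < n) (hdvd : ¬ k ∣ 2 * n) (L : Type) [Field L] [NumberField L] [IsGalois ℚ L]
    (v₀ : Fin n → L) (hv₀ : ∏ i, (X - C (v₀ i)) = (X ^ n + X ^ k + 1 : L[X])) :
    ∃ (κ : Type) (_ : Field κ) (_ : Algebra (ZMod 2) κ) (a : Fin n → κ)
      (π : Equiv.Perm (Fin n)), Function.Injective a ∧
      ∏ i, (X - C (a i)) = (X ^ n + X ^ k + 1 : κ[X]) ∧ (∀ i, a (π i) = a i ^ 2) ∧
      Equiv.Perm.sign π = if n % 8 = 1 then 1 else -1 := by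
  have hodd : Odd n := by rw [Nat.odd_iff]; omega
  have hint (i : Fin n) : IsIntegral ℤ (v₀ i) := by
    refine ⟨X ^ n + X ^ k + 1, monic_trinomial hkn, ?_⟩
    have h1 := congrArg (eval (v₀ i)) hv₀
    rw [eval_prod, Finset.prod_eq_zero (Finset.mem_univ i) (by simp)] at h1
    simpa using h1.symm
  let v (i : Fin n) : 𝓞 L := ⟨v₀ i, hint i⟩
  have hv : ∏ i, (X - C (v i)) = (X ^ n + X ^ k + 1 : (𝓞 L)[X]) := by
    apply Polynomial.map_injective (algebraMap (𝓞 L) L) RingOfIntegers.coe_injective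
    rw [Polynomial.map_prod]
    simp only [Polynomial.map_sub, Polynomial.map_add, Polynomial.map_pow, map_X, map_C,
      Polynomial.map_one]
    exact hv₀
  obtain ⟨P, hP, f, h2, hf⟩ := exists_frobenius_two L
  obtain ⟨y, hD⟩ := exists_disc_eq_add_eight_mul hn hk hke hkn hdvd v hv
  let q := Ideal.Quotient.mk P
  let _ : Field (𝓞 L ⧸ P) := Ideal.Quotient.field P
  have hq2 : (2 : 𝓞 L ⧸ P) = 0 := by
    have : q 2 = 0 := Ideal.Quotient.eq_zero_iff_mem.mpr h2
    rwa [map_ofNat] at this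
  have : CharP (𝓞 L ⧸ P) 2 := CharTwo.of_one_ne_zero_of_two_eq_zero one_ne_zero hq2
  let _ : Algebra (ZMod 2) (𝓞 L ⧸ P) := ZMod.algebra _ 2
  have hn1 : (n : 𝓞 L ⧸ P) = 1 := by
    obtain ⟨t, rfl⟩ := hodd
    push_cast
    rw [hq2]; ring
  have hk0 : (k : 𝓞 L ⧸ P) = 0 := by
    obtain ⟨t, rfl⟩ := hke
    push_cast
    linear_combination (t : 𝓞 L ⧸ P) * hq2
  have ha : ∏ i, (X - C (q (v i))) = (X ^ n + X ^ k + 1 : (𝓞 L ⧸ P)[X]) := by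
    have := congrArg (Polynomial.map q) hv
    simpa [Polynomial.map_prod] using this
  have hdet : (Matrix.vandermonde v).det ≠ 0 := by
    intro h0
    have := congrArg q hD
    rw [h0] at this
    simp only [map_pow, map_zero, map_add, map_mul, map_natCast, map_ofNat, hn1] at this
    apply one_ne_zero (α := 𝓞 L ⧸ P)
    linear_combination -this - 4 * q y * hq2
  -- In characteristic two `x f'(x) = x ^ n`, so a repeated root would be 0, which is not a root.
  have hainj : Function.Injective fun i => q (v i) := by
    intro i j hij
    by_contra hne
    have h1 := eval_derivative_prod_X_sub_C (fun i => q (v i)) i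
    rw [ha, Finset.prod_eq_zero (i := j) (by simpa using Ne.symm hne) (sub_eq_zero.mpr hij)] at h1
    have h3 := mul_eval_derivative_trinomial hodd.pos hk (q (v i))
    rw [h1, hn1, hk0] at h3
    have h4 := congrArg (eval (q (v i))) ha
    rw [eval_prod, Finset.prod_eq_zero (Finset.mem_univ i) (by simp)] at h4
    have h5 : q (v i) = 0 := by
      refine eq_zero_of_pow_eq_zero (n := n) ?_
      linear_combination -h3
    simp [h5, hodd.pos.ne', hk.ne'] at h4
  have hvinj : Function.Injective v := fun i j hij => hainj (congrArg q hij)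
  obtain ⟨π, hπ⟩ := exists_perm_of_map_root v hv hvinj f f.injective
  refine ⟨𝓞 L ⧸ P, inferInstance, inferInstance, fun i => q (v i), π, hainj, ha, fun i => ?_, ?_⟩
  · change q (v (π i)) = q (v i) ^ 2
    rw [← hπ, ← map_pow]
    exact Ideal.Quotient.eq.mpr (hf (v i))
  -- The product of the sums is Galois-invariant and integral, hence a rational integer.
  · have hinv := Algebra.isInvariant_of_isGalois' ℤ ℚ L (𝓞 L)
    obtain ⟨m, hm⟩ := hinv.isInvariant (∏ i, ∏ j ∈ Finset.Ioi i, (v j + v i)) fun g => by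
      obtain ⟨ρ, hρ⟩ := exists_perm_of_map_root v hv hvinj g g.injective
      exact map_prod_add_eq v hdet g ρ hρ
    exact sign_frobenius v P h2 f hf π hπ m (by simpa using hm.symm) y hn hD

/-- A characteristic-zero field has only one `ℚ`-algebra structure, so the one carried by the
splitting field may be exchanged for the canonical one. -/
theorem numberField_and_isGalois_of_isSplittingField (F : ℚ[X]) (L : Type) [Field L] [CharZero L]
    [a : Algebra ℚ L] [hs : IsSplittingField ℚ L F] :
    ∃ _ : NumberField L, @IsGalois ℚ _ L _ DivisionRing.toRatAlgebra := by
  obtain rfl : a = DivisionRing.toRatAlgebra := Subsingleton.elim _ _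
  have : FiniteDimensional ℚ L := IsSplittingField.finiteDimensional L F
  have : Normal ℚ L := Normal.of_isSplittingField F
  exact ⟨{ to_charZero := inferInstance, to_finiteDimensional := inferInstance }, IsGalois.mk⟩

/-- Swan's theorem on trinomials: the sign of the Frobenius permutation of the roots of
`X ^ n + X ^ k + 1` in characteristic two. -/
theorem exists_frobenius_perm_roots {n k : ℕ} (hn : n % 4 = 1) (hk : 0 < k) (hke : Even k)
    (hkn : k < n) (hdvd : ¬ k ∣ 2 * n) :
    ∃ (κ : Type) (_ : Field κ) (_ : Algebra (ZMod 2) κ) (a : Fin n → κ)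
      (π : Equiv.Perm (Fin n)), Function.Injective a ∧
      ∏ i, (X - C (a i)) = (X ^ n + X ^ k + 1 : κ[X]) ∧ (∀ i, a (π i) = a i ^ 2) ∧
      Equiv.Perm.sign π = if n % 8 = 1 then 1 else -1 := by
  obtain ⟨F, hF⟩ : ∃ F : ℚ[X], F = X ^ n + X ^ k + 1 := ⟨_, rfl⟩
  have hmap : F.map (algebraMap ℚ F.SplittingField) = X ^ n + X ^ k + 1 := by
    have h1 := congrArg (Polynomial.map (algebraMap ℚ F.SplittingField)) hF
    exact h1.trans (by simp)
  obtain ⟨v, hv⟩ := exists_fin_prod_X_sub_C (n := n) (F.map (algebraMap ℚ F.SplittingField))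
    (by rw [hmap]; exact monic_trinomial hkn) (SplittingField.splits F)
    (by rw [hmap, natDegree_trinomial hkn])
  obtain ⟨_, _⟩ := @numberField_and_isGalois_of_isSplittingField F F.SplittingField _ _ _
    (IsSplittingField.splittingField F)
  exact exists_frobenius_perm_roots_of_prod hn hk hke hkn hdvd F.SplittingField v (hv.trans hmap)

/-! ### Irreducible trinomials and the Frobenius permutation. -/

theorem pow_two_pow_eq_of_irreducible {K : Type*} [Field K] [Algebra (ZMod 2) K] {D : (ZMod 2)[X]}
    (hD : Irreducible D) (x : K) (hx : aeval x D = 0) : x ^ 2 ^ D.natDegree = x := by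
  obtain ⟨q, hq⟩ := hD.natDegree_dvd_iff_dvd_X_pow_card_pow_sub_X.mp (dvd_refl D.natDegree)
  have h := congrArg (aeval x) hq
  rw [map_mul, hx, zero_mul, Nat.card_zmod] at h
  simpa [sub_eq_zero] using h

theorem apply_perm_pow {K : Type*} [Field K] {n : ℕ} (a : Fin n → K) (π : Equiv.Perm (Fin n))
    (h : ∀ i, a (π i) = a i ^ 2) (j : ℕ) (i : Fin n) : a ((π ^ j) i) = a i ^ 2 ^ j := by
  induction j generalizing i with
  | zero => simp
  | succ j ih => rw [pow_succ, Equiv.Perm.mul_apply, ih, h, ← pow_mul, ← pow_succ']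

theorem root_of_prod {K : Type*} [Field K] {n k : ℕ} (a : Fin n → K)
    (h : ∏ i, (X - C (a i)) = (X ^ n + X ^ k + 1 : K[X])) (i : Fin n) :
    a i ^ n + a i ^ k + 1 = 0 := by
  have h1 := congrArg (eval (a i)) h
  rw [eval_prod, Finset.prod_eq_zero (Finset.mem_univ i) (by simp)] at h1
  simpa using h1.symm

/-- Swan: a trinomial of degree `5` modulo `8` is reducible, if the middle exponent `k` is even and
does not divide `2n`. -/
theorem not_irreducible_trinomial {n k : ℕ} (hn : n % 8 = 5) (hk : 0 < k) (hke : Even k)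
    (hkn : k < n) (hdvd : ¬ k ∣ 2 * n) : ¬ Irreducible (X ^ n + X ^ k + 1 : (ZMod 2)[X]) := by
  intro hirr
  obtain ⟨κ, _, _, a, π, hinj, hprod, hπ, hsign⟩ :=
    exists_frobenius_perm_roots (by omega) hk hke hkn hdvd
  have h1 : π ^ n = 1 := by
    ext1 i
    apply hinj
    rw [apply_perm_pow a π hπ]
    have := pow_two_pow_eq_of_irreducible hirr (a i) (by simpa using root_of_prod a hprod i)
    rwa [natDegree_trinomial hkn] at this
  have h2 := congrArg Equiv.Perm.sign h1
  have hodd : Odd n := by rw [Nat.odd_iff]; omega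
  rw [map_pow, hsign, if_neg (by omega), hodd.neg_one_pow, map_one] at h2
  exact absurd h2 (by decide)

theorem X_sq_add_X_add_one_dvd_X_pow_three_mul_sub_one (t : ℕ) :
    (X ^ 2 + X + 1 : (ZMod 2)[X]) ∣ X ^ (3 * t) - 1 := by
  have h1 : (X ^ 3 - 1 : (ZMod 2)[X]) ∣ (X ^ 3) ^ t - 1 := by
    simpa using sub_dvd_pow_sub_pow (X ^ 3 : (ZMod 2)[X]) 1 t
  rw [pow_mul]
  exact (Dvd.intro_left (X - 1) (by ring)).trans h1

theorem natDegree_X_sq_add_X_add_one : (X ^ 2 + X + 1 : (ZMod 2)[X]).natDegree = 2 := by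
  simpa using natDegree_trinomial (R := ZMod 2) one_lt_two

theorem not_irreducible_of_mod_three {n : ℕ} (hn : n % 3 = 1) (h2 : 2 < n) :
    ¬ Irreducible (X ^ n + X ^ 2 + 1 : (ZMod 2)[X]) := by
  intro hirr
  have hd : (X ^ 2 + X + 1 : (ZMod 2)[X]) ∣ X ^ n + X ^ 2 + 1 := by
    obtain ⟨t, rfl⟩ : ∃ t, n = 3 * t + 1 := ⟨n / 3, by omega⟩
    obtain ⟨q, hq⟩ := X_sq_add_X_add_one_dvd_X_pow_three_mul_sub_one t
    exact ⟨X * q + 1, by rw [pow_succ]; linear_combination X * hq⟩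
  have hdeg := natDegree_X_sq_add_X_add_one
  rcases hirr.dvd_iff.mp hd with hu | ha
  · rw [natDegree_eq_zero_of_isUnit hu] at hdeg
    omega
  · have := natDegree_eq_of_degree_eq (degree_eq_degree_of_associated ha)
    rw [hdeg, natDegree_trinomial h2] at this
    omega

/-! ### A quartic cofactor and the parity of Frobenius. -/

/-- A permutation with four-element support and trivial fourth power, whose square moves every
point of the support, is a four-cycle, hence odd. -/
theorem sign_eq_neg_one_of_four_cycle {α : Type*} [Fintype α] [DecidableEq α] (τ : Equiv.Perm α)
    (hcard : τ.support.card = 4) (h2 : ∀ i ∈ τ.support, (τ ^ 2) i ≠ i) (h4 : τ ^ 4 = 1) :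
    Equiv.Perm.sign τ = -1 := by
  obtain ⟨x, hx⟩ : τ.support.Nonempty := by rw [← Finset.card_pos, hcard]; norm_num
  have h1 : τ x ≠ x := Equiv.Perm.mem_support.mp hx
  have h2x := h2 x hx
  have h3 : (τ ^ 3) x ≠ x := fun h => h1 (by
    have h5 : (τ ^ 4) x = x := by rw [h4, Equiv.Perm.one_apply]
    rwa [pow_succ', Equiv.Perm.mul_apply, h] at h5)
  have hmem (j : ℕ) : (τ ^ j) x ∈ τ.support := Equiv.Perm.pow_apply_mem_support.mpr hx
  have hS : (Finset.range 4).image (fun j => (τ ^ j) x) = τ.support := by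
    apply Finset.eq_of_subset_of_card_le
    · intro y hy
      obtain ⟨j, -, rfl⟩ := Finset.mem_image.mp hy
      exact hmem j
    · rw [hcard, Finset.card_image_of_injOn, Finset.card_range]
      have key (i j : ℕ) (hij : i < j) (hj : j < 4) : (τ ^ i) x ≠ (τ ^ j) x := by
        obtain ⟨d, rfl⟩ := Nat.exists_eq_add_of_lt hij
        intro h
        rw [add_assoc, pow_add, Equiv.Perm.mul_apply] at h
        have h' := ((τ ^ i).injective h).symm
        have hd : d = 0 ∨ d = 1 ∨ d = 2 := by omega
        rcases hd with rfl | rfl | rfl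
        · exact h1 (by simpa using h')
        · exact h2x h'
        · exact h3 h'
      intro i hi j hj hij
      rcases lt_trichotomy i j with h | h | h
      · exact absurd hij (key i j h (by simpa using hj))
      · exact h
      · exact absurd hij.symm (key j i h (by simpa using hi))
  have hcyc : τ.IsCycle := by
    refine ⟨x, h1, fun y hy => ?_⟩
    rw [← Equiv.Perm.mem_support, ← hS] at hy
    obtain ⟨j, -, rfl⟩ := Finset.mem_image.mp hy
    exact ⟨j, by simp⟩
  rw [hcyc.sign, hcard]
  decide

/-- If `X ^ n + X ^ k + 1` with `n = 1` modulo `8` factors as an irreducible polynomial of odd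
degree times a quartic `h` all of whose roots generate the field with `16` elements, then `k`
divides `2n`. -/
theorem dvd_of_eq_irreducible_mul_quartic {n k : ℕ} (hn : n % 8 = 1) (hk : 0 < k) (hke : Even k)
    (hkn : k < n) {D h : (ZMod 2)[X]} (hD : Irreducible D) (hDh : X ^ n + X ^ k + 1 = D * h)
    (hh : h.natDegree = 4) (hodd : Odd D.natDegree)
    (hroot : ∀ (K : Type) [Field K] [Algebra (ZMod 2) K] (x : K), aeval x h = 0 →
      x ^ 16 = x ∧ x ^ 4 ≠ x) : k ∣ 2 * n := by
  by_contra hdvd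
  obtain ⟨κ, _, _, a, π, hinj, hprod, hπ, hsign⟩ :=
    exists_frobenius_perm_roots (by omega) hk hke hkn hdvd
  classical
  rw [if_pos hn] at hsign
  have hD0 := hD.ne_zero
  have hh0 : h ≠ 0 := by rintro rfl; simp at hh
  have hcases (i : Fin n) : aeval (a i) D = 0 ∨ aeval (a i) h = 0 := by
    rw [← mul_eq_zero, ← map_mul, ← hDh]
    simpa using root_of_prod a hprod i
  have hdeg : n = D.natDegree + 4 := by
    rw [← hh, ← natDegree_mul hD0 hh0, ← hDh, natDegree_trinomial hkn]
  have hroots (f : (ZMod 2)[X]) (hf : f ≠ 0) :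
      (Finset.univ.filter fun i => aeval (a i) f = 0).card ≤ f.natDegree := by
    have hf' : f.map (algebraMap (ZMod 2) κ) ≠ 0 := map_ne_zero hf
    rw [← Finset.card_image_of_injective _ hinj]
    refine le_trans ?_ ((card_roots' (f.map (algebraMap (ZMod 2) κ))).trans natDegree_map_le)
    refine le_trans (Finset.card_le_card fun y hy => ?_) (Multiset.toFinset_card_le _)
    obtain ⟨i, hi, rfl⟩ := Finset.mem_image.mp hy
    rw [Multiset.mem_toFinset, mem_roots hf', IsRoot, eval_map_algebraMap]
    exact (Finset.mem_filter.mp hi).2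
  set B := Finset.univ.filter fun i => aeval (a i) h = 0 with hB
  have hBcard : B.card = 4 := by
    apply le_antisymm (hh ▸ hroots h hh0)
    -- All `n` roots are distinct and `D` accounts for at most `n - 4` of them, so `h` has at least
    -- four.
    have h1 : Bᶜ.card ≤ D.natDegree := by
      refine le_trans (Finset.card_le_card fun i hi => ?_) (hroots D hD0)
      simp only [hB, Finset.mem_compl, Finset.mem_filter, Finset.mem_univ, true_and] at hi ⊢
      exact (hcases i).resolve_right hi
    rw [Finset.card_compl, Fintype.card_fin] at h1
    omega
  have h16 (x : κ) (hx : x ^ 16 = x) (t : ℕ) : x ^ 16 ^ t = x := by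
    induction t with
    | zero => simp
    | succ t ih => rw [pow_succ, pow_mul, ih, hx]
  have happ := apply_perm_pow a π hπ
  obtain ⟨t, ht⟩ := id hodd
  -- As `deg D` is odd, twice it is 2 mod 4, and this power of Frobenius acts on the field with 16
  -- elements as `x ↦ x ^ 4`.
  have h2B (i : Fin n) (hi : i ∈ B) : ((π ^ D.natDegree) ^ 2) i ≠ i := by
    obtain ⟨hx, hx'⟩ := hroot κ (a i) (Finset.mem_filter.mp hi).2
    intro hfix
    have := congrArg a hfix
    rw [← pow_mul, happ, ht, show 2 ^ ((2 * t + 1) * 2) = 16 ^ t * 4 by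
      rw [show (2 * t + 1) * 2 = 4 * t + 2 by ring, pow_add, pow_mul]; norm_num,
      pow_mul, h16 _ hx] at this
    exact hx' this
  have hDfix (i : Fin n) (hi : i ∉ B) : (π ^ D.natDegree) i = i := by
    apply hinj
    rw [happ]
    apply pow_two_pow_eq_of_irreducible hD
    exact (hcases i).resolve_right (by simpa [hB] using hi)
  have hsupp : (π ^ D.natDegree).support = B := by
    ext i
    rw [Equiv.Perm.mem_support]
    refine ⟨fun hi => by_contra fun hiB => hi (hDfix i hiB), fun hi hfix => h2B i hi ?_⟩
    rw [pow_two, Equiv.Perm.mul_apply, hfix, hfix]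
  have h4 : (π ^ D.natDegree) ^ 4 = 1 := by
    ext1 i
    by_cases hi : i ∈ B
    · apply hinj
      obtain ⟨hx, -⟩ := hroot κ (a i) (Finset.mem_filter.mp hi).2
      rw [← pow_mul, happ, mul_comm, pow_mul]
      exact h16 _ hx _
    · have h1 := hDfix i hi
      simp only [pow_succ, pow_zero, one_mul, Equiv.Perm.mul_apply, Equiv.Perm.one_apply] at h1 ⊢
      simp only [h1]
  have hneg := sign_eq_neg_one_of_four_cycle (π ^ D.natDegree) (by rw [hsupp, hBcard])
    (by rw [hsupp]; exact h2B) h4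
  rw [map_pow, hsign, one_pow] at hneg
  exact absurd hneg (by decide)

/-! ### Certificates for the roots of irreducible quartics. -/

theorem two_eq_zero_of_algebra (K : Type*) [Field K] [Algebra (ZMod 2) K] : (2 : K) = 0 := by
  have : CharP K 2 := charP_of_injective_algebraMap (algebraMap (ZMod 2) K).injective 2
  exact CharTwo.two_eq_zero

/-- The quartic polynomials over `GF(2)` that are irreducible. -/
def IsIrreducibleQuartic (h : (ZMod 2)[X]) : Prop :=
  h = X ^ 4 + X ^ 3 + 1 ∨ h = X ^ 4 + X + 1 ∨ h = X ^ 4 + X ^ 3 + X ^ 2 + X + 1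

/-- The multiplier of `hb` is the quotient of `X ^ 15 - 1` by `h` over GF(2), lifted to integer
coefficients; the multiple of `h2` absorbs the even discrepancy. -/
theorem IsIrreducibleQuartic.pow_fifteen {h : (ZMod 2)[X]} (hh : IsIrreducibleQuartic h)
    {K : Type*} [Field K] [Algebra (ZMod 2) K] {b : K} (hb : aeval b h = 0) : b ^ 15 = 1 := by
  have h2 := two_eq_zero_of_algebra K
  rcases hh with rfl | rfl | rfl <;> simp only [map_add, map_pow, aeval_X, map_one] at hb
  · linear_combination (1 + b ^ 3 + b ^ 4 + b ^ 6 + b ^ 8 + b ^ 9 + b ^ 10 + b ^ 11) * hb + (-1 - b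
      ^ 3 - b ^ 4 - b ^ 6 - b ^ 7 - b ^ 8 - b ^ 9 - b ^ 10 - b ^ 11 - b ^ 12 - b ^ 13 - b ^ 14)
      * h2
  · linear_combination (1 + b + b ^ 2 + b ^ 3 + b ^ 5 + b ^ 7 + b ^ 8 + b ^ 11) * hb + (-1 - b - b
      ^ 2 - b ^ 3 - b ^ 4 - b ^ 5 - b ^ 6 - b ^ 7 - b ^ 8 - b ^ 9 - b ^ 11 - b ^ 12) * h2
  · linear_combination (1 + b + b ^ 5 + b ^ 6 + b ^ 10 + b ^ 11) * hb + (-1 - b - b ^ 2 - b ^ 3 - b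
      ^ 4 - b ^ 5 - b ^ 6 - b ^ 7 - b ^ 8 - b ^ 9 - b ^ 10 - b ^ 11 - b ^ 12 - b ^ 13 - b ^ 14)
      * h2

theorem IsIrreducibleQuartic.pow_four_ne {h : (ZMod 2)[X]} (hh : IsIrreducibleQuartic h)
    {K : Type*} [Field K] [Algebra (ZMod 2) K] {b : K} (hb : aeval b h = 0) : b ^ 4 ≠ b := by
  intro h4
  have h2 := two_eq_zero_of_algebra K
  apply one_ne_zero (α := K)
  rcases hh with rfl | rfl | rfl <;> simp only [map_add, map_pow, aeval_X, map_one] at hb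
  · linear_combination (1 + b ^ 2 + b ^ 3) * hb + (b + b ^ 3) * h4 + (-b ^ 3 - b ^ 5 - b ^ 6 - b ^
      7) * h2
  · linear_combination 1 * hb + 1 * h4 + (-b ^ 4) * h2
  · linear_combination (1 + b + b ^ 3) * hb + (b ^ 2 + b ^ 3) * h4 + (-b - b ^ 2 - b ^ 3 - b ^ 4 -
      b ^ 5 - b ^ 6 - b ^ 7) * h2

/-- Exponents reduce modulo 15. For `k ≡ 2, 4` a Bézout identity shows the reduced trinomial coprime
to each quartic; for `k ≡ 11` the two powers cancel, leaving 1. -/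
theorem IsIrreducibleQuartic.trinomial_ne_zero {h : (ZMod 2)[X]} (hh : IsIrreducibleQuartic h)
    {K : Type*} [Field K] [Algebra (ZMod 2) K] {b : K} (hb : aeval b h = 0) {n k : ℕ}
    (hn : n % 15 = 11) (hk : k % 15 = 2 ∨ k % 15 = 4 ∨ k % 15 = 11) : b ^ n + b ^ k + 1 ≠ 0 := by
  intro ht
  have h2 := two_eq_zero_of_algebra K
  have hmod (m : ℕ) : b ^ m = b ^ (m % 15) := by
    conv_lhs => rw [← Nat.div_add_mod m 15, pow_add, pow_mul, hh.pow_fifteen hb, one_pow, one_mul]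
  rw [hmod n, hmod k, hn] at ht
  apply one_ne_zero (α := K)
  rcases hk with hk | hk | hk <;> rw [hk] at ht
  · rcases hh with rfl | rfl | rfl <;> simp only [map_add, map_pow, aeval_X, map_one] at hb
    · linear_combination (b + b ^ 2 + b ^ 3 + b ^ 4 + b ^ 8) * hb + (1 + b) * ht + (-b - b ^ 2 - b ^
        3 - b ^ 4 - b ^ 5 - b ^ 6 - b ^ 7 - b ^ 8 - b ^ 11 - b ^ 12) * h2
    · linear_combination (b ^ 4 + b ^ 5 + b ^ 6 + b ^ 7 + b ^ 9) * hb + (1 + b ^ 2) * ht + (-b ^ 2 -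
        b ^ 4 - b ^ 5 - b ^ 6 - b ^ 7 - b ^ 8 - b ^ 9 - b ^ 10 - b ^ 11 - b ^ 13) * h2
    · linear_combination (b ^ 2 + b ^ 4 + b ^ 5 + b ^ 6 + b ^ 7 + b ^ 9 + b ^ 10) * hb + (1 + b ^ 3)
        * ht + (-b ^ 2 - b ^ 3 - b ^ 4 - 2 * b ^ 5 - 2 * b ^ 6 - 2 * b ^ 7 - 2 * b ^ 8 - 2 * b ^ 9
        - 2 * b ^ 10 - 2 * b ^ 11 - b ^ 12 - b ^ 13 - b ^ 14) * h2
  · rcases hh with rfl | rfl | rfl <;> simp only [map_add, map_pow, aeval_X, map_one] at hb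
    · linear_combination (b + b ^ 2 + b ^ 3 + b ^ 5 + b ^ 6 + b ^ 8 + b ^ 10) * hb + (1 + b + b ^ 2 +
        b ^ 3) * ht + (-b - b ^ 2 - b ^ 3 - b ^ 4 - 2 * b ^ 5 - 2 * b ^ 6 - b ^ 7 - b ^ 8 - b ^ 9
        - b ^ 10 - b ^ 11 - b ^ 12 - b ^ 13 - b ^ 14) * h2
    · linear_combination (1 + b ^ 3 + b ^ 5 + b ^ 6 + b ^ 7 + b ^ 8 + b ^ 10) * hb + (b + b ^ 3) * ht
        + (-b - b ^ 3 - b ^ 4 - b ^ 5 - b ^ 6 - 2 * b ^ 7 - b ^ 8 - b ^ 9 - b ^ 10 - b ^ 11 - b ^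
        12 - b ^ 14) * h2
    · linear_combination (b ^ 2 + b ^ 5 + b ^ 6 + b ^ 7 + b ^ 8 + b ^ 10) * hb + (1 + b ^ 2 + b ^ 3)
        * ht + (-b ^ 2 - b ^ 3 - b ^ 4 - b ^ 5 - 2 * b ^ 6 - 2 * b ^ 7 - 2 * b ^ 8 - 2 * b ^ 9 - 2
        * b ^ 10 - 2 * b ^ 11 - b ^ 12 - b ^ 13 - b ^ 14) * h2
  · linear_combination ht - b ^ 11 * h2

/-! ### Reciprocal polynomials and even middle exponent. -/

theorem reverse_reverse_of_coeff_zero_ne {R : Type*} [Field R] {f : R[X]} (h0 : f.coeff 0 ≠ 0) :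
    f.reverse.reverse = f ∧ f.reverse.natDegree = f.natDegree := by
  have hd : f.reverse.natDegree = f.natDegree := by
    rw [reverse_natDegree, natTrailingDegree_eq_zero_of_constantCoeff_ne_zero h0, Nat.sub_zero]
  refine ⟨?_, hd⟩
  ext m
  rw [reverse, hd, reverse, coeff_reflect, coeff_reflect, revAt_invol]

theorem irreducible_reverse {R : Type*} [Field R] {f : R[X]} (hf : Irreducible f)
    (h0 : f.coeff 0 ≠ 0) : Irreducible f.reverse := by
  obtain ⟨hrr, hd⟩ := reverse_reverse_of_coeff_zero_ne h0
  refine ⟨fun hu => hf.not_isUnit ?_, fun a b hab => ?_⟩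
  · rw [isUnit_iff_degree_eq_zero, degree_eq_natDegree hf.ne_zero, ← hd,
      natDegree_eq_zero_of_isUnit hu, Nat.cast_zero]
  · have h1 : f.reverse.coeff 0 ≠ 0 := by
      rw [coeff_zero_reverse]
      exact leadingCoeff_ne_zero.mpr hf.ne_zero
    rw [hab, mul_coeff_zero] at h1
    have key (g : R[X]) (hg : g.coeff 0 ≠ 0) (hu : IsUnit g.reverse) : IsUnit g := by
      have hg0 : g ≠ 0 := by rintro rfl; simp at hg
      rw [isUnit_iff_degree_eq_zero, degree_eq_natDegree hg0,
        ← (reverse_reverse_of_coeff_zero_ne hg).2, natDegree_eq_zero_of_isUnit hu, Nat.cast_zero]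
    have h2 : f = a.reverse * b.reverse := by rw [← reverse_mul_of_domain, ← hab, hrr]
    exact (hf.isUnit_or_isUnit h2).imp (key a (left_ne_zero_of_mul h1))
      (key b (right_ne_zero_of_mul h1))

theorem eval_trinomial {n s : ℕ} (hs : 0 < s) (hsn : s < n) (x : ZMod 2) :
    (X ^ n + X ^ s + 1 : (ZMod 2)[X]).eval x = 1 := by
  have hx : x = 0 ∨ x = 1 := by revert x; decide
  rcases hx with rfl | rfl
  · simp [hs.ne', (hs.trans hsn).ne']
  · simp only [eval_add, eval_pow, eval_X, one_pow, eval_one]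
    decide

/-- Passing to the reciprocal trinomial, one may take the middle exponent to be even. -/
theorem exists_even_factorization {n s : ℕ} (hn : Odd n) (hs : 0 < s) (hsn : s < n)
    {D h : (ZMod 2)[X]} (hD : Irreducible D) (hDh : X ^ n + X ^ s + 1 = D * h) :
    ∃ (k : ℕ) (D' h' : (ZMod 2)[X]), 0 < k ∧ k < n ∧ Even k ∧ Irreducible D' ∧
      X ^ n + X ^ k + 1 = D' * h' ∧ D'.natDegree = D.natDegree := by
  rcases Nat.even_or_odd s with he | ho
  · exact ⟨s, D, h, hs, hsn, he, hD, hDh, rfl⟩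
  · have h0 : D.coeff 0 ≠ 0 := by
      rw [coeff_zero_eq_eval_zero]
      apply left_ne_zero_of_mul (b := h.eval 0)
      rw [← eval_mul, ← hDh, eval_trinomial hs hsn]
      exact one_ne_zero
    refine ⟨n - s, D.reverse, h.reverse, by omega, by omega, Nat.Odd.sub_odd hn ho,
      irreducible_reverse hD h0, ?_, (reverse_reverse_of_coeff_zero_ne h0).2⟩
    rw [← reverse_mul_of_domain, ← hDh, reverse_trinomial hsn]

/-! ### Cofactors of degree two and four. -/

theorem isCoprime_X_sq_add_X_add_one_X_pow (m : ℕ) :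
    IsCoprime (X ^ 2 + X + 1 : (ZMod 2)[X]) (X ^ m) :=
  IsCoprime.pow_right ⟨1, -(X + 1), by ring⟩

theorem not_X_sq_add_X_add_one_dvd_X_pow (m : ℕ) : ¬ (X ^ 2 + X + 1 : (ZMod 2)[X]) ∣ X ^ m := by
  intro h
  have hu := (isCoprime_X_sq_add_X_add_one_X_pow m).isUnit_of_dvd' dvd_rfl h
  have := natDegree_eq_zero_of_isUnit hu
  rw [natDegree_X_sq_add_X_add_one] at this
  omega

theorem two_eq_zero_polynomial : (2 : (ZMod 2)[X]) = 0 := CharTwo.two_eq_zero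

/-- A quadratic factor of a trinomial has no roots, hence is `X ^ 2 + X + 1`. -/
theorem natDegree_ne_two_of_dvd_trinomial {n s : ℕ} (hn : n % 3 = 0)
    {h : (ZMod 2)[X]} (hd : h ∣ X ^ n + X ^ s + 1)
    (hev : ∀ x, h.eval x = 1) : h.natDegree ≠ 2 := by
  intro h2
  have hlc : h.coeff 2 ≠ 0 := by
    have hl : h.leadingCoeff ≠ 0 := leadingCoeff_ne_zero.mpr (by rintro rfl; simp at h2)
    rwa [leadingCoeff, h2] at hl
  have hform := h.as_sum_range_C_mul_X_pow
  rw [h2] at hform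
  simp only [Finset.sum_range_succ, Finset.sum_range_zero] at hform
  have hz := hev 0
  have ho := hev 1
  rw [hform] at hz ho
  simp at hz ho
  have key : ∀ c0 c1 c2 : ZMod 2, c2 ≠ 0 → c0 = 1 → c0 + c1 + c2 = 1 → c1 = 1 ∧ c2 = 1 := by decide
  obtain ⟨hc1, hc2⟩ := key _ _ _ hlc hz ho
  have hq : h = X ^ 2 + X + 1 := by
    rw [hform, hz, hc1, hc2]
    simp only [C_1]
    ring
  rw [hq] at hd
  obtain ⟨t, rfl⟩ : ∃ t, n = 3 * t := ⟨n / 3, by omega⟩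
  -- Modulo `X ^ 2 + X + 1` the trinomial reduces to `X ^ s`, because `3 ∣ n`.
  have h3 := dvd_sub hd (X_sq_add_X_add_one_dvd_X_pow_three_mul_sub_one t)
  apply not_X_sq_add_X_add_one_dvd_X_pow s
  convert h3 using 1
  linear_combination -two_eq_zero_polynomial

theorem isIrreducibleQuartic_or_eq_sq {h : (ZMod 2)[X]} (h4 : h.natDegree = 4)
    (hev : ∀ x, h.eval x = 1) : IsIrreducibleQuartic h ∨ h = (X ^ 2 + X + 1) ^ 2 := by
  have hlc : h.coeff 4 ≠ 0 := by
    have hl : h.leadingCoeff ≠ 0 := leadingCoeff_ne_zero.mpr (by rintro rfl; simp at h4)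
    rwa [leadingCoeff, h4] at hl
  have hform := h.as_sum_range_C_mul_X_pow
  rw [h4] at hform
  simp only [Finset.sum_range_succ, Finset.sum_range_zero] at hform
  have hz := hev 0
  have ho := hev 1
  rw [hform] at hz ho
  simp at hz ho
  have key : ∀ c0 c1 c2 c3 c4 : ZMod 2, c4 ≠ 0 → c0 = 1 → c0 + c1 + c2 + c3 + c4 = 1 → c4 = 1 ∧
      ((c1 = 0 ∧ c2 = 0 ∧ c3 = 1) ∨ (c1 = 1 ∧ c2 = 0 ∧ c3 = 0) ∨ (c1 = 1 ∧ c2 = 1 ∧ c3 = 1) ∨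
        (c1 = 0 ∧ c2 = 1 ∧ c3 = 0)) := by decide
  obtain ⟨hc4, hc⟩ := key _ _ _ _ _ hlc hz ho
  rw [hz, hc4] at hform
  rcases hc with ⟨h1, h2, h3⟩ | ⟨h1, h2, h3⟩ | ⟨h1, h2, h3⟩ | ⟨h1, h2, h3⟩ <;>
    rw [h1, h2, h3] at hform <;> simp only [C_0, C_1] at hform
  · exact .inl (.inl (by rw [hform]; ring))
  · exact .inl (.inr (.inl (by rw [hform]; ring)))
  · exact .inl (.inr (.inr (by rw [hform]; ring)))
  · refine .inr ?_
    rw [hform]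
    linear_combination (-X ^ 3 - X ^ 2 - X) * two_eq_zero_polynomial

/-- A squared factor divides the derivative, which is `X ^ (n - 1)` for odd `n` and even `k`. -/
theorem not_sq_dvd_trinomial {n k : ℕ} (hn : Odd n) (hk : 0 < k) (hke : Even k) :
    ¬ (X ^ 2 + X + 1 : (ZMod 2)[X]) ^ 2 ∣ X ^ n + X ^ k + 1 := by
  rintro ⟨c, hc⟩
  have h1 := congrArg derivative hc
  have hnc : (n : (ZMod 2)[X]) = 1 := by
    obtain ⟨t, rfl⟩ := hn
    push_cast
    linear_combination (t : (ZMod 2)[X]) * two_eq_zero_polynomial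
  have hkc : (k : (ZMod 2)[X]) = 0 := by
    obtain ⟨t, rfl⟩ := hke
    push_cast
    linear_combination (t : (ZMod 2)[X]) * two_eq_zero_polynomial
  rw [derivative_mul, derivative_pow, derivative_add, derivative_add, derivative_X_pow,
    derivative_X_pow, derivative_one, map_natCast, map_natCast, hnc, hkc] at h1
  apply not_X_sq_add_X_add_one_dvd_X_pow (n - 1)
  refine ⟨C ((2 : ℕ) : ZMod 2) * derivative (X ^ 2 + X + 1) * c
    + (X ^ 2 + X + 1) * derivative c, ?_⟩
  linear_combination h1

/-! ### Excluding the increments. -/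

theorem eval_eq_one_of_mul_eq_trinomial {n s : ℕ} (hs : 0 < s) (hsn : s < n) {D h : (ZMod 2)[X]}
    (hDh : X ^ n + X ^ s + 1 = D * h) (x : ZMod 2) : h.eval x = 1 := by
  have h1 := eval_trinomial hs hsn x
  rw [hDh, eval_mul] at h1
  revert h1
  generalize D.eval x = u
  generalize h.eval x = w
  revert u w
  decide

theorem increment_ne_zero {n s : ℕ} (hs : 0 < s) (hsn : s < n) {D h : (ZMod 2)[X]}
    (hD : Irreducible D) (hDh : X ^ n + X ^ s + 1 = D * h) (hp : n.Prime) (hn8 : n % 8 = 5)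
    (hn3 : n % 3 = 1) : D.natDegree ≠ n := by
  intro hdeg
  have hodd : Odd n := by rw [Nat.odd_iff]; omega
  obtain ⟨k, D, h, hk, hkn, hke, hD, hDh, hdeg'⟩ := exists_even_factorization hodd hs hsn hD hDh
  have h1 := natDegree_trinomial (R := ZMod 2) hkn
  have hh0 : h ≠ 0 := by
    rintro rfl
    rw [hDh, mul_zero, natDegree_zero] at h1
    omega
  rw [hDh, natDegree_mul hD.ne_zero hh0] at h1
  have hu : IsUnit h := by
    rw [isUnit_iff_degree_eq_zero, degree_eq_natDegree hh0, show h.natDegree = 0 by omega,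
      Nat.cast_zero]
  have hirr : Irreducible (X ^ n + X ^ k + 1 : (ZMod 2)[X]) := by
    rw [hDh]
    exact (irreducible_mul_isUnit hu).mpr hD
  have hdvd : k ∣ 2 * n := by
    by_contra hdvd
    exact not_irreducible_trinomial hn8 hk hke hkn hdvd hirr
  obtain ⟨d, rfl⟩ := hke
  rw [← two_mul] at hdvd
  rcases (Nat.dvd_prime hp).mp (Nat.dvd_of_mul_dvd_mul_left two_pos hdvd) with rfl | rfl
  · exact not_irreducible_of_mod_three hn3 hkn hirr
  · omega

theorem increment_ne_four {n s : ℕ} (hs : 0 < s) (hsn : s < n) {D h : (ZMod 2)[X]}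
    (hD : Irreducible D) (hDh : X ^ n + X ^ s + 1 = D * h) (hn8 : n % 8 = 1) (hn15 : n % 15 = 11)
    (hdiv : ∀ k, Even k → k < n → k ∣ 2 * n → k % 15 = 2 ∨ k % 15 = 4 ∨ k % 15 = 11) :
    D.natDegree + 4 ≠ n := by
  intro hdeg
  have hodd : Odd n := by rw [Nat.odd_iff]; omega
  obtain ⟨k, D, h, hk, hkn, hke, hD, hDh, hdeg'⟩ := exists_even_factorization hodd hs hsn hD hDh
  have h1 := natDegree_trinomial (R := ZMod 2) hkn
  have hh0 : h ≠ 0 := by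
    rintro rfl
    rw [hDh, mul_zero, natDegree_zero] at h1
    omega
  rw [hDh, natDegree_mul hD.ne_zero hh0] at h1
  have hh4 : h.natDegree = 4 := by omega
  have hq : IsIrreducibleQuartic h := by
    refine (isIrreducibleQuartic_or_eq_sq hh4
      (eval_eq_one_of_mul_eq_trinomial hk hkn hDh)).resolve_right ?_
    rintro rfl
    exact not_sq_dvd_trinomial hodd hk hke (Dvd.intro_left D hDh.symm)
  have hdvd : k ∣ 2 * n := by
    refine dvd_of_eq_irreducible_mul_quartic hn8 hk hke hkn hD hDh hh4
      (by rw [Nat.odd_iff]; omega) fun K _ _ x hx => ⟨?_, hq.pow_four_ne hx⟩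
    rw [pow_succ, hq.pow_fifteen hx, one_mul]
  obtain ⟨x, hx⟩ := IsAlgClosed.exists_aeval_eq_zero (AlgebraicClosure (ZMod 2)) h
    (by rw [degree_eq_natDegree hh0, hh4]; norm_num)
  refine hq.trinomial_ne_zero hx hn15 (hdiv k hke hkn hdvd) ?_
  have h2 := congrArg (aeval x) hDh
  rw [map_mul, hx, mul_zero] at h2
  simpa using h2

/-- Two non-associated irreducible factors are coprime, so their degrees, each above half, would sum
past `deg P`. -/
theorem HasExponent.unique {P : (ZMod 2)[X]} {r r' : ℕ} (h : HasExponent P r)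
    (h' : HasExponent P r') : r = r' := by
  obtain ⟨hP, hr, D, hD, hDP, rfl⟩ := h
  obtain ⟨-, hr', D', hD', hDP', rfl⟩ := h'
  by_cases ha : Associated D D'
  · exact natDegree_eq_of_degree_eq (degree_eq_degree_of_associated ha)
  · have hP0 : P ≠ 0 := by rintro rfl; simp at hP
    have hc : IsCoprime D D' := hD.coprime_iff_not_dvd.mpr fun hd =>
      ha (hD.associated_of_dvd hD' hd)
    have := natDegree_le_of_dvd (hc.mul_dvd hDP hDP') hP0
    rw [natDegree_mul hD.ne_zero hD'.ne_zero] at this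
    omega

theorem theorem6p3 (T : (ZMod 2)[X]) (hT : IsTrinomial T) (hai : IsAlmostIrreducible T)
    (hexp : HasExponent T 13466917) (δ : ℕ) (hinc : HasIncrement T δ) :
    δ ∉ ({0, 1, 2, 4} : Set ℕ) := by
  obtain ⟨r, hr, hdeg⟩ := hinc
  obtain rfl := hr.unique hexp
  obtain ⟨n, s, hs, hsn, rfl⟩ := hT
  obtain ⟨-, -, D, hD, ⟨h, hDh⟩, hDdeg⟩ := hexp
  have hev := eval_eq_one_of_mul_eq_trinomial hs hsn hDh
  have hh0 : h ≠ 0 := by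
    rintro rfl
    simpa using hev 0
  have hhdeg : h.natDegree = δ := by
    rw [hDh, natDegree_mul hD.ne_zero hh0] at hdeg
    omega
  rw [natDegree_trinomial hsn] at hdeg
  rintro (rfl | rfl | rfl | rfl)
  · refine increment_ne_zero hs hsn hD hDh ?_ (by omega) (by omega) (by omega)
    rw [hdeg]
    norm_num
  · obtain ⟨x, hx⟩ := exists_root_of_degree_eq_one (p := h)
      (by rw [degree_eq_natDegree hh0, hhdeg, Nat.cast_one])
    rw [IsRoot, hev] at hx
    exact one_ne_zero hx
  · exact natDegree_ne_two_of_dvd_trinomial (by omega) (Dvd.intro_left D hDh.symm) hev hhdeg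
  · refine increment_ne_four hs hsn hD hDh (by omega) (by omega) (fun k hke hkn hk => ?_)
      (by omega)
    obtain ⟨d, rfl⟩ := hke
    rw [← two_mul] at hk
    have hd := Nat.dvd_of_mul_dvd_mul_left two_pos hk
    rw [hdeg, show 13466917 + 4 = 13 * 1035917 by norm_num] at hd
    obtain ⟨d₁, d₂, h₁, h₂, rfl⟩ := (Nat.dvd_mul).mp hd
    -- The surviving `k` are 2, 26 and 2071834, congruent to 2, 11 and 4 modulo 15.
    rcases (Nat.dvd_prime (by norm_num)).mp h₁ with rfl | rfl <;>
      rcases (Nat.dvd_prime (by norm_num)).mp h₂ with rfl | rfl <;> omega
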